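/- Let $d\ge 0$ be an integer, let $\varepsilon>0$, and let $\mathcal K$ be a complex Hilbert space. For a $d$-tuple $Z=(Z_1,\dots,Z_d)$ of $n\times n$ complex matrices put $\|Z\|=\max_i\|Z_i\|$ (operator norms), and for a word $\alpha=x_{i_1}\cdots x_{i_k}$ in the noncommuting letters $x_1,\dots,x_d$ put $Z^\alpha=Z_{i_1}\cdots Z_{i_k}$, $Z^{1}=I$ for the empty word $1$, and $\alpha^*=x_{i_k}\cdots x_{i_1}$. Let $B_{\mathbb C}(0,1+\varepsilon)$ be the set of all such tuples, of all sizes $n$, with $\|Z\|<1+\varepsilon$, and let $B_{\mathbb R}(0,1+\varepsilon)$ be the subset of the tuples of Hermitian matrices. For operators $A$ and matrices $M$ write $AM$ for $A\otimes M$. Let $c_\alpha\in\mathcal B(\mathcal K)$ be given for every word $\alpha$, and let $f$ be a function on $B_{\mathbb C}(0,1+\varepsilon)$, with $f(Z)\in\mathcal B(\mathcal K)\otimes M_n(\mathbb C)=\mathcal B(\mathcal K\otimes\mathbb C^n)$ for $Z$ of size $n$, such that $$f(Z)=\sum_\alpha c_\alpha Z^\alpha ,$$ where the series over all words converges absolutely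 at each point of $B_{\mathbb C}(0,1+\varepsilon)$ and uniformly on $B_{\mathbb C}(0,1+\varepsilon)$. Suppose that $f$ is matrix convex on $B_{\mathbb R}(0,1+\varepsilon)$, that is, $f(X)$ is self-adjoint for every $X\in B_{\mathbb R}(0,1+\varepsilon)$, and $f\left(\frac{A+B}{2}\right)\le\frac{f(A)+f(B)}{2}$ for all $A,B\in B_{\mathbb R}(0,1+\varepsilon)$ of the same size. Then the block matrix $[c_{\beta^*\alpha}]_{\alpha,\beta}$, where $\alpha,\beta$ range over all words of degree at least $1$, is positive semidefinite. Let $\mathcal H$ be the Hilbert space obtained (by dividing out the null vectors and completing) from the span of the symbols $\alpha\otimes v$, with $\alpha$ a word of degree at least $1$ and $v\in\mathcal K$, equipped with the semi-inner product $$\langle\alpha\otimes v,\beta\otimes w\rangle=w^*c_{\beta^*\alpha}v .$$ For each $i=1,\dots,d$, the formula $T_i(\alpha\otimes v)=x_i\alpha\otimes v$ defines a bounded self-adjoint operator on $\mathcal H$ with $\|T_i\|\le 1$, and $Q_iv=x_i\otimes v$ defines a bounded operator $Q_i:\mathcal K\to\mathcal H$. Moreover, there are a self-adjoint $a_0\in\mathcal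 B(\mathcal K)$ and a continuous real-linear map $L:\mathbb R^d\to\mathcal B(\mathcal K)$ with self-adjoint values, extended to tuples of matrices by $L(Z)=\sum_i L(e_i)Z_i$, such that for every $Z\in B_{\mathbb C}(0,1+\varepsilon)$ the operator $I-\sum_iT_iZ_i$ is invertible and $$f(Z)=a_0+L(Z)+\Big(\sum_i Q_iZ_i^*\Big)^*\Big(I-\sum_i T_iZ_i\Big)^{-1}\Big(\sum_i Q_iZ_i\Big).$$ -/

import Mathlib

noncomputable section

namespace Butterfly

open scoped Matrix.Norms.L2Operator

/-! ### Words, tuples of matrices and the balls -/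

/-- Words in the noncommuting letters `x_1, …, x_d`; the empty word `[]` is the unit `1`. -/
abbrev Word (d : ℕ) : Type := List (Fin d)

/-- The involution on words: it reverses the order of the letters. -/
def Word.adj {d : ℕ} (α : Word d) : Word d := List.reverse α

/-- The words of degree at least one. -/
abbrev PosWord (d : ℕ) : Type := {α : Word d // α ≠ []}

/-- The word `x_i`. -/
def PosWord.letter {d : ℕ} (i : Fin d) : PosWord d := ⟨[i], by simp⟩

/-- The word `x_i α`. -/
def PosWord.cons {d : ℕ} (i : Fin d) (α : PosWord d) : PosWord d := ⟨i :: α.1, by simp⟩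

/-- Level `n` of the matrix universe over `ℝ^d`: `d`-tuples of `n × n` complex matrices. -/
abbrev Tuple (d n : ℕ) : Type := Fin d → Matrix (Fin n) (Fin n) ℂ

/-- The monomial `Z^α`. -/
def monomial {d n : ℕ} (Z : Tuple d n) (α : Word d) : Matrix (Fin n) (Fin n) ℂ :=
  (α.map Z).prod

/-- Level `n` of the complex ball `B_ℂ(0, r)` over the operator system `ℝ^d`
(the self-adjoint diagonal matrices), so the norm of a tuple is the maximum of the operator norms
of its entries. -/
def complexBall (d : ℕ) (r : ℝ) (n : ℕ) : Set (Tuple d n) :=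
  {Z | ∀ i, ‖Z i‖ < r}

/-- Level `n` of the real ball `B_ℝ(0, r)`: the tuples of Hermitian matrices in the ball. -/
def realBall (d : ℕ) (r : ℝ) (n : ℕ) : Set (Tuple d n) :=
  {X | (∀ i, (X i).IsHermitian) ∧ ∀ i, ‖X i‖ < r}

/-! ### Matrices over `B(K)` -/

/-- The Hilbert space `K ⊗ ℂ^n`. -/
abbrev Amp (K : Type*) (n : ℕ) : Type _ := PiLp 2 (fun _ : Fin n => K)

section Operators

variable {K H : Type*} [NormedAddCommGroup K] [InnerProductSpace ℂ K]
  [NormedAddCommGroup H] [InnerProductSpace ℂ H]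

/-- The operator `A ⊗ Z : K ⊗ ℂ^n → H ⊗ ℂ^n`, that is the block matrix `[Z_{ij} A]`. -/
def tens {n : ℕ} (A : K →L[ℂ] H) (Z : Matrix (Fin n) (Fin n) ℂ) : Amp K n →L[ℂ] Amp H n :=
  ((PiLp.continuousLinearEquiv 2 ℂ (fun _ : Fin n => H)).symm :
      (Fin n → H) →L[ℂ] Amp H n) ∘L
    ContinuousLinearMap.pi fun i =>
      ∑ j, Z i j • (A ∘L PiLp.proj 2 (𝕜 := ℂ) (fun _ : Fin n => K) j)

theorem tens_apply {n : ℕ} (A : K →L[ℂ] H) (Z : Matrix (Fin n) (Fin n) ℂ) (x : Amp K n)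
    (i : Fin n) : tens A Z x i = ∑ j, Z i j • A (x j) := by
  simp [tens]

/-- A graded function: it sends a `d`-tuple of `n × n` matrices to an `n × n` matrix over
`B(K)`, that is an operator on `K ⊗ ℂ^n`. -/
abbrev GradedFun (d : ℕ) (K : Type*) [NormedAddCommGroup K] [InnerProductSpace ℂ K] : Type _ :=
  ∀ n : ℕ, Tuple d n → (Amp K n →L[ℂ] Amp K n)

/-- The power series `∑ c_α Z^α` over all words converges to `f`, absolutely at each point of
`B_ℂ(0, r)` and uniformly on `B_ℂ(0, r)` (over all matrix sizes at once). -/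
def ConvergesAbsUnif {d : ℕ} (c : Word d → K →L[ℂ] K) (f : GradedFun d K) (r : ℝ) : Prop :=
  (∀ n, ∀ Z ∈ complexBall d r n, Summable fun α : Word d => ‖tens (c α) (monomial Z α)‖) ∧
  ∀ η : ℝ, 0 < η → ∃ F₀ : Finset (Word d), ∀ F : Finset (Word d), F₀ ⊆ F →
    ∀ n, ∀ Z ∈ complexBall d r n, ‖f n Z - ∑ α ∈ F, tens (c α) (monomial Z α)‖ < η

/-- `f` is matrix convex on `G`: it takes self-adjoint values and is midpoint convex at each
level, with respect to the Loewner order on operators. -/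
def MatrixConvexOn {d : ℕ} [CompleteSpace K] (G : ∀ n, Set (Tuple d n)) (f : GradedFun d K) :
    Prop :=
  (∀ n, ∀ X ∈ G n, IsSelfAdjoint (f n X)) ∧
  ∀ n, ∀ A ∈ G n, ∀ B ∈ G n,
    f n ((2⁻¹ : ℂ) • (A + B)) ≤ (2⁻¹ : ℂ) • (f n A + f n B)

end Operators

/-! ### The Hilbert space of the block matrix `[c_{β* α}]` -/

section HilbertSpace

variable {d : ℕ} {K : Type*} [NormedAddCommGroup K] [InnerProductSpace ℂ K]

/-- The sesquilinear form (conjugate linear in the first variable) on finite sums of symbols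
`α ⊗ v` that is determined by `⟨β ⊗ w, α ⊗ v⟩ = ⟨w, c_{β* α} v⟩`. -/
def form (c : Word d → K →L[ℂ] K) (ξ η : PosWord d →₀ K) : ℂ :=
  ξ.sum fun β w => η.sum fun α v => inner ℂ w (c (β.1.adj ++ α.1) v)

/-- The block matrix `[c_{β* α}]`, indexed by the words of degree at least one, is positive
semidefinite. -/
structure IsPositiveKernel [CompleteSpace K] (c : Word d → K →L[ℂ] K) : Prop where
  hermitian : ∀ α β : PosWord d,
    ContinuousLinearMap.adjoint (c (β.1.adj ++ α.1)) = c (α.1.adj ++ β.1)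
  nonneg : ∀ ξ : PosWord d →₀ K, 0 ≤ (form c ξ ξ).re

theorem form_add_left (c : Word d → K →L[ℂ] K) (ξ ξ' η : PosWord d →₀ K) :
    form c (ξ + ξ') η = form c ξ η + form c ξ' η := by
  unfold form
  apply Finsupp.sum_add_index'
  · intro β; simp
  · intro β w w'; simp only [inner_add_left, Finsupp.sum_add]

theorem form_smul_left (c : Word d → K →L[ℂ] K) (ξ η : PosWord d →₀ K) (r : ℂ) :
    form c (r • ξ) η = (starRingEnd ℂ) r * form c ξ η := by
  unfold form
  rw [Finsupp.sum_smul_index' (by intro β; simp)]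
  simp only [inner_smul_left, Finsupp.sum, Finset.mul_sum]

variable [CompleteSpace K] {c : Word d → K →L[ℂ] K}

theorem IsPositiveKernel.form_conj (h : IsPositiveKernel c) (ξ η : PosWord d →₀ K) :
    (starRingEnd ℂ) (form c η ξ) = form c ξ η := by
  unfold form
  simp only [Finsupp.sum, map_sum, inner_conj_symm]
  rw [Finset.sum_comm]
  refine Finset.sum_congr rfl fun β _ => Finset.sum_congr rfl fun α _ => ?_
  rw [← h.hermitian α β, ContinuousLinearMap.adjoint_inner_left]

/-- Finite sums of symbols `α ⊗ v` with `α` of degree at least one and `v ∈ K`, to be equipped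
with the semi-inner product `form c`. -/
def PreSpace (_ : IsPositiveKernel c) : Type _ := PosWord d →₀ K

variable (h : IsPositiveKernel c)

instance : AddCommGroup (PreSpace h) := inferInstanceAs (AddCommGroup (PosWord d →₀ K))
instance : Module ℂ (PreSpace h) := inferInstanceAs (Module ℂ (PosWord d →₀ K))

/-- The semi-inner product. -/
abbrev preCore : PreInnerProductSpace.Core ℂ (PreSpace h) where
  inner ξ η := form c ξ η
  conj_inner_symm ξ η := h.form_conj ξ η
  re_inner_nonneg ξ := h.nonneg ξ
  add_left ξ ξ' η := form_add_left c ξ ξ' η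
  smul_left ξ η r := form_smul_left c ξ η r

instance : SeminormedAddCommGroup (PreSpace h) :=
  InnerProductSpace.Core.toSeminormedAddCommGroup (c := preCore h)
instance : InnerProductSpace ℂ (PreSpace h) := InnerProductSpace.ofCore (preCore h)

/-- The Hilbert space: the (Hausdorff) completion, in which null vectors are identified
with zero. -/
abbrev Space : Type _ := UniformSpace.Completion (PreSpace h)

/-- The vector `α ⊗ v` of the Hilbert space. -/
def vec (α : PosWord d) (v : K) : Space h :=
  ((show PreSpace h from Finsupp.single α v : PreSpace h) : Space h)

theorem inner_vec (α β : PosWord d) (v w : K) :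
    inner ℂ (vec h β w) (vec h α v) = inner ℂ w (c (β.1.adj ++ α.1) v) := by
  unfold vec
  rw [UniformSpace.Completion.inner_coe]
  change form c (Finsupp.single β w) (Finsupp.single α v) = _
  simp [form]

end HilbertSpace

end Butterfly

end

open Butterfly

/-!
Let `ℓ_i w = w x_i` on the Fock space spanned by the words, truncated in degree. A matrix entry of a
monomial in the operators `ℓ_i + ℓ_i*` counts walks in the tree of words, and the shortest walk from
`a` to `b` through the vacuum spells `a* b`. Give the edges at the vacuum the weight `θ`. The tuple
for `θ = 0` is the midpoint of those for `θ = ±1`, and in the convexity defect of `f` along this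
segment only walks through the vacuum survive. Evaluating at `s` times these tuples and dividing by
the right powers of `s`, the limit `s → 0` isolates `c_{a* b}` in the entry `(a, b)`; hence the
block matrix is positive. In the same way `c_α* = c_{α*}` follows from the self-adjointness of `f`.

If `A` is symmetric then `k ↦ ‖A^k ξ‖` is log-convex, so geometric growth `‖A^k ξ‖ ≤ C q^k` forces
`‖A ξ‖ ≤ q ‖ξ‖`; since `‖A^k ξ‖² = ⟨ξ, A^{2k} ξ⟩`, it is enough to bound the moments `⟨ξ, A^k ξ⟩`.
For the shifts `T_i` these moments are coefficients of the series, whose absolute convergence gives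
`‖T_i‖ ≤ 1 / r` on a ball of radius `r`. For `A = P* P`, with `P = ∑ T_i ⊗ Z_i`, they are sums of
coefficients, and the same convergence gives `‖P‖ < 1` on the ball. The Neumann series of
`(1 - P)⁻¹` then sums the terms of degree at least two of the series of `f`.
-/

noncomputable section

namespace Butterfly

open scoped Matrix.Norms.L2Operator
open ContinuousLinearMap (adjoint)
open Filter Topology

section PowerGrowth

theorem le_of_forall_pow_le_mul_pow {x y C : ℝ} (hy : 0 ≤ y) (h : ∀ k : ℕ, x ^ k ≤ C * y ^ k) :
    x ≤ y := by
  rcases hy.eq_or_lt with rfl | hy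
  · simpa using h 1
  · by_contra! hlt
    obtain ⟨k, hk⟩ := pow_unbounded_of_one_lt C ((one_lt_div hy).2 hlt)
    rw [div_pow, lt_div_iff₀ (by positivity)] at hk
    exact (h k).not_gt hk

variable {a : ℕ → ℝ}

theorem one_mul_le_zero_mul_succ_of_logConvex (h₀ : ∀ k, 0 ≤ a k)
    (ha : ∀ k, a (k + 1) ^ 2 ≤ a k * a (k + 2)) (k : ℕ) : a 1 * a k ≤ a 0 * a (k + 1) := by
  induction k with
  | zero => rw [mul_comm]
  | succ k ih =>
    rcases (h₀ (k + 1)).eq_or_lt with hk | hk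
    · rw [← hk, mul_zero]
      exact mul_nonneg (h₀ 0) (h₀ _)
    · refine le_of_mul_le_mul_right ?_ hk
      calc a 1 * a (k + 1) * a (k + 1) = a 1 * a (k + 1) ^ 2 := by ring
        _ ≤ a 1 * (a k * a (k + 2)) := mul_le_mul_of_nonneg_left (ha k) (h₀ 1)
        _ = a 1 * a k * a (k + 2) := by ring
        _ ≤ a 0 * a (k + 1) * a (k + 2) := mul_le_mul_of_nonneg_right ih (h₀ _)
        _ = a 0 * a (k + 2) * a (k + 1) := by ring

theorem one_pow_mul_zero_le_of_logConvex (h₀ : ∀ k, 0 ≤ a k)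
    (ha : ∀ k, a (k + 1) ^ 2 ≤ a k * a (k + 2)) (k : ℕ) : a 1 ^ k * a 0 ≤ a 0 ^ k * a k := by
  induction k with
  | zero => simp
  | succ k ih =>
    calc a 1 ^ (k + 1) * a 0 = a 1 * (a 1 ^ k * a 0) := by ring
      _ ≤ a 1 * (a 0 ^ k * a k) := mul_le_mul_of_nonneg_left ih (h₀ 1)
      _ = a 0 ^ k * (a 1 * a k) := by ring
      _ ≤ a 0 ^ k * (a 0 * a (k + 1)) :=
        mul_le_mul_of_nonneg_left (one_mul_le_zero_mul_succ_of_logConvex h₀ ha k)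
          (pow_nonneg (h₀ 0) k)
      _ = a 0 ^ (k + 1) * a (k + 1) := by ring

theorem one_le_mul_zero_of_logConvex {C q : ℝ} (hq : 0 ≤ q) (h₀ : ∀ k, 0 ≤ a k)
    (ha : ∀ k, a (k + 1) ^ 2 ≤ a k * a (k + 2)) (hC : ∀ k, a k ≤ C * q ^ k) :
    a 1 ≤ q * a 0 := by
  rcases (h₀ 0).eq_or_lt with h | h
  · have h1 := ha 0
    rw [← h, zero_mul] at h1
    rw [← h, mul_zero]
    exact (pow_eq_zero_iff two_ne_zero |>.1 (le_antisymm h1 (sq_nonneg _))).le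
  · refine le_of_forall_pow_le_mul_pow (C := C / a 0) (mul_nonneg hq (h₀ 0)) fun k => ?_
    rw [div_mul_eq_mul_div, le_div_iff₀ h]
    calc a 1 ^ k * a 0 ≤ a 0 ^ k * a k := one_pow_mul_zero_le_of_logConvex h₀ ha k
      _ ≤ a 0 ^ k * (C * q ^ k) := mul_le_mul_of_nonneg_left (hC k) (pow_nonneg (h₀ 0) k)
      _ = C * (q * a 0) ^ k := by ring

end PowerGrowth

section SymmetricGrowth

variable {𝕜 E : Type*} [RCLike 𝕜] [SeminormedAddCommGroup E] [InnerProductSpace 𝕜 E]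
  {A : E →ₗ[𝕜] E} {q : ℝ}

theorem norm_sq_pow_succ_le_of_isSymmetric (hA : A.IsSymmetric) (ξ : E) (k : ℕ) :
    ‖(A ^ (k + 1)) ξ‖ ^ 2 ≤ ‖(A ^ k) ξ‖ * ‖(A ^ (k + 2)) ξ‖ := by
  rw [← inner_self_eq_norm_sq (𝕜 := 𝕜), pow_succ' A k, Module.End.mul_apply, hA,
    ← Module.End.mul_apply, ← Module.End.mul_apply, ← sq, ← pow_add, add_comm 2]
  exact (RCLike.re_le_norm _).trans (norm_inner_le_norm _ _)

theorem norm_apply_le_of_isSymmetric_of_norm_pow_le (hA : A.IsSymmetric) (hq : 0 ≤ q) {ξ : E}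
    {C : ℝ} (hC : ∀ k, ‖(A ^ k) ξ‖ ≤ C * q ^ k) : ‖A ξ‖ ≤ q * ‖ξ‖ := by
  simpa using one_le_mul_zero_of_logConvex hq (fun k => norm_nonneg ((A ^ k) ξ))
    (norm_sq_pow_succ_le_of_isSymmetric hA ξ) hC

theorem norm_pow_le_of_isSymmetric_of_norm_inner_le (hA : A.IsSymmetric) (hq : 0 ≤ q) {ξ : E}
    {C : ℝ} (hC : ∀ k, ‖inner 𝕜 ξ ((A ^ k) ξ)‖ ≤ C * q ^ k) (k : ℕ) :
    ‖(A ^ k) ξ‖ ≤ √C * q ^ k := by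
  rw [← Real.sqrt_sq (pow_nonneg hq k), ← Real.sqrt_mul' _ (sq_nonneg _)]
  refine Real.le_sqrt_of_sq_le ?_
  rw [← inner_self_eq_norm_sq (𝕜 := 𝕜), hA.pow k ξ, ← Module.End.mul_apply, ← pow_add,
    ← pow_mul, mul_two]
  exact (RCLike.re_le_norm _).trans (hC _)

theorem exists_norm_pow_le_of_mem_span {S : Set E}
    (hS : ∀ ξ ∈ S, ∃ C : ℝ, ∀ k, ‖(A ^ k) ξ‖ ≤ C * q ^ k) {ξ : E}
    (hξ : ξ ∈ Submodule.span 𝕜 S) : ∃ C : ℝ, ∀ k, ‖(A ^ k) ξ‖ ≤ C * q ^ k := by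
  induction hξ using Submodule.span_induction with
  | mem ξ hξ => exact hS ξ hξ
  | zero => exact ⟨0, fun k => by simp⟩
  | add ξ η _ _ hξ hη =>
    obtain ⟨C, hC⟩ := hξ
    obtain ⟨C', hC'⟩ := hη
    refine ⟨C + C', fun k => ?_⟩
    rw [map_add, add_mul]
    exact norm_add_le_of_le (hC k) (hC' k)
  | smul z ξ _ hξ =>
    obtain ⟨C, hC⟩ := hξ
    refine ⟨‖z‖ * C, fun k => ?_⟩
    rw [map_smul, norm_smul, mul_assoc]
    exact mul_le_mul_of_nonneg_left (hC k) (norm_nonneg z)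

theorem norm_apply_le_of_isSymmetric_of_mem_span (hA : A.IsSymmetric) (hq : 0 ≤ q) {S : Set E}
    (hS : ∀ ξ ∈ S, ∃ C : ℝ, ∀ k, ‖inner 𝕜 ξ ((A ^ k) ξ)‖ ≤ C * q ^ k) {ξ : E}
    (hξ : ξ ∈ Submodule.span 𝕜 S) : ‖A ξ‖ ≤ q * ‖ξ‖ := by
  obtain ⟨C, hC⟩ := exists_norm_pow_le_of_mem_span
    (fun η hη => (hS η hη).imp' Real.sqrt fun _ =>
      norm_pow_le_of_isSymmetric_of_norm_inner_le hA hq) hξ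
  exact norm_apply_le_of_isSymmetric_of_norm_pow_le hA hq hC

end SymmetricGrowth

section Tens

variable {K H G : Type*} [NormedAddCommGroup K] [InnerProductSpace ℂ K]
  [NormedAddCommGroup H] [InnerProductSpace ℂ H] [NormedAddCommGroup G] [InnerProductSpace ℂ G]
  {n : ℕ}

theorem tens_comp (A : H →L[ℂ] G) (B : K →L[ℂ] H) (Z W : Matrix (Fin n) (Fin n) ℂ) :
    tens A Z ∘L tens B W = tens (A ∘L B) (Z * W) := by
  ext x i
  simp only [ContinuousLinearMap.comp_apply, tens_apply, map_sum, map_smul, Matrix.mul_apply,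
    Finset.sum_smul, Finset.smul_sum, smul_smul]
  rw [Finset.sum_comm]

theorem tens_one : tens (1 : K →L[ℂ] K) (1 : Matrix (Fin n) (Fin n) ℂ) = 1 := by
  ext x i
  simp [tens_apply, Matrix.one_apply, ite_smul]

theorem prod_ofFn_tens {k : ℕ} (A : Fin k → K →L[ℂ] K)
    (Z : Fin k → Matrix (Fin n) (Fin n) ℂ) :
    (List.ofFn fun j => tens (A j) (Z j)).prod = tens (List.ofFn A).prod (List.ofFn Z).prod := by
  induction k with
  | zero => simp [tens_one]
  | succ k ih =>
    simp only [List.ofFn_succ, List.prod_cons, ih, ContinuousLinearMap.mul_def, tens_comp]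

theorem adjoint_tens [CompleteSpace K] [CompleteSpace H] (A : K →L[ℂ] H)
    (Z : Matrix (Fin n) (Fin n) ℂ) : adjoint (tens A Z) = tens (adjoint A) Z.conjTranspose := by
  symm
  rw [ContinuousLinearMap.eq_adjoint_iff]
  intro x y
  simp only [PiLp.inner_apply, tens_apply, sum_inner, inner_sum, inner_smul_left, inner_smul_right,
    Matrix.conjTranspose_apply, ContinuousLinearMap.adjoint_inner_left]
  rw [Finset.sum_comm]
  simp

end Tens

section Entry

variable {K H : Type*} [NormedAddCommGroup K] [InnerProductSpace ℂ K]
  [NormedAddCommGroup H] [InnerProductSpace ℂ H] {n : ℕ}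

/-- The isometric embedding `v ↦ v ⊗ e_a` of `K` into `K ⊗ ℂ^n`. -/
def single (a : Fin n) : K →L[ℂ] Amp K n :=
  ((PiLp.continuousLinearEquiv 2 ℂ (fun _ : Fin n => K)).symm : (Fin n → K) →L[ℂ] Amp K n) ∘L
    ContinuousLinearMap.single ℂ (fun _ : Fin n => K) a

theorem single_apply (a : Fin n) (v : K) : single a v = PiLp.single 2 a v := rfl

theorem norm_single_apply (a : Fin n) (v : K) : ‖single a v‖ = ‖v‖ := by
  rw [single_apply, PiLp.norm_single]

theorem sum_single (x : Amp K n) : ∑ a, single a (x a) = x := by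
  ext b
  simp [single_apply]

theorem inner_single_left (a : Fin n) (v : K) (x : Amp K n) :
    inner ℂ (single a v) x = inner ℂ v (x a) := by
  rw [PiLp.inner_apply, Finset.sum_eq_single a]
  · rw [single_apply, PiLp.single_eq_same]
  · intro b _ hb
    rw [single_apply, PiLp.single_eq_of_ne 2 hb, inner_zero_left]
  · simp

/-- The block `(a, b)` of an operator `K ⊗ ℂ^n → H ⊗ ℂ^n`, a continuous linear function of the
operator. -/
def entry (a b : Fin n) : (Amp K n →L[ℂ] Amp H n) →L[ℂ] K →L[ℂ] H :=
  ((PiLp.proj 2 (𝕜 := ℂ) (fun _ : Fin n => H) a).postcomp K) ∘L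
    ((single (K := K) b).precomp (Amp H n))

theorem entry_apply (a b : Fin n) (A : Amp K n →L[ℂ] Amp H n) (v : K) :
    entry a b A v = A (single b v) a := rfl

theorem norm_entry_le (a b : Fin n) (A : Amp K n →L[ℂ] Amp H n) : ‖entry a b A‖ ≤ ‖A‖ := by
  refine ContinuousLinearMap.opNorm_le_bound _ (norm_nonneg A) fun v => ?_
  rw [entry_apply, ← norm_single_apply b v]
  exact (PiLp.norm_apply_le _ a).trans (A.le_opNorm _)

theorem entry_tens (a b : Fin n) (A : K →L[ℂ] H) (Z : Matrix (Fin n) (Fin n) ℂ) :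
    entry a b (tens A Z) = Z a b • A := by
  ext v
  rw [entry_apply, tens_apply, Finset.sum_eq_single b]
  · simp [single_apply]
  · intro c _ hc
    rw [single_apply, PiLp.single_eq_of_ne 2 hc, map_zero, smul_zero]
  · simp

theorem inner_single_apply_single (a b : Fin n) (A : Amp K n →L[ℂ] Amp H n) (v : H) (w : K) :
    inner ℂ (single a v) (A (single b w)) = inner ℂ v (entry a b A w) := by
  rw [inner_single_left, entry_apply]

theorem adjoint_entry [CompleteSpace K] [CompleteSpace H] (a b : Fin n)
    (A : Amp K n →L[ℂ] Amp H n) : adjoint (entry a b A) = entry b a (adjoint A) := by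
  symm
  rw [ContinuousLinearMap.eq_adjoint_iff]
  intro v w
  rw [← inner_single_apply_single, ← inner_conj_symm, ← inner_single_apply_single, inner_conj_symm,
    ContinuousLinearMap.adjoint_inner_left]

end Entry

section Monomial

variable {d n : ℕ}

@[simp] theorem monomial_nil (Z : Tuple d n) : monomial Z [] = 1 := rfl

@[simp] theorem monomial_cons (Z : Tuple d n) (i : Fin d) (α : Word d) :
    monomial Z (i :: α) = Z i * monomial Z α := by simp [monomial]

theorem monomial_append (Z : Tuple d n) (α β : Word d) :
    monomial Z (α ++ β) = monomial Z α * monomial Z β := by simp [monomial]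

theorem monomial_smul (s : ℂ) (Z : Tuple d n) (α : Word d) :
    monomial (s • Z) α = s ^ α.length • monomial Z α := by
  induction α with
  | nil => simp
  | cons i α ih => simp [ih, smul_smul, pow_succ]

theorem monomial_cons_apply (Z : Tuple d n) (i : Fin d) (w : Word d) (a b : Fin n) :
    monomial Z (i :: w) a b = ∑ c, Z i a c * monomial Z w c b := by
  rw [monomial_cons, Matrix.mul_apply]

theorem monomial_reverse {Z : Tuple d n} (hZ : ∀ i, (Z i).IsSymm) (α : Word d) :
    monomial Z α.reverse = (monomial Z α).transpose := by
  induction α with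
  | nil => simp
  | cons i α ih => simp [monomial_append, ih, (hZ i).eq]

end Monomial

section Series

variable {d : ℕ} {K : Type*} [NormedAddCommGroup K] [InnerProductSpace ℂ K]
  {c : Word d → K →L[ℂ] K} {f : GradedFun d K} {r : ℝ}

/-- The power series `∑ c_α Z^α` converges absolutely to `f` at each point of `B_ℂ(0, r)`. -/
def ConvergesAbs (c : Word d → K →L[ℂ] K) (f : GradedFun d K) (r : ℝ) : Prop :=
  ∀ n, ∀ Z ∈ complexBall d r n, (Summable fun α : Word d => ‖tens (c α) (monomial Z α)‖) ∧
    HasSum (fun α => tens (c α) (monomial Z α)) (f n Z)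

theorem ConvergesAbsUnif.convergesAbs (h : ConvergesAbsUnif c f r) : ConvergesAbs c f r := by
  refine fun n Z hZ => ⟨h.1 n Z hZ, ?_⟩
  rw [HasSum, SummationFilter.unconditional_filter]
  refine (Metric.tendsto_atTop (α := Amp K n →L[ℂ] Amp K n) (β := Finset (Word d))).2 fun η hη => ?_
  obtain ⟨F₀, hF⟩ := h.2 η hη
  refine ⟨F₀, fun F hFF => ?_⟩
  rw [dist_comm]
  exact (dist_eq_norm (f n Z) _).trans_lt (hF F hFF n Z hZ)

/-- The coefficients `c_α` are absolutely summable against `ρ^|α|` for every `0 ≤ ρ < r`: the trace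
on the coefficients of the convergence of `∑ c_α Z^α` on scalar tuples. -/
def AbsSummableBelow {E : Type*} [Norm E] (c : Word d → E) (r : ℝ) : Prop :=
  ∀ ρ, 0 ≤ ρ → ρ < r → Summable fun α => ‖c α‖ * ρ ^ α.length

theorem ConvergesAbs.hasSum_entry (h : ConvergesAbs c f r) {n : ℕ} {Z : Tuple d n}
    (hZ : Z ∈ complexBall d r n) (a b : Fin n) :
    HasSum (fun α => monomial Z α a b • c α) (entry a b (f n Z)) := by
  simpa only [entry_tens] using (h n Z hZ).2.mapL (entry a b)

theorem ConvergesAbs.summable_norm_entry (h : ConvergesAbs c f r) {n : ℕ} {Z : Tuple d n}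
    (hZ : Z ∈ complexBall d r n) (a b : Fin n) :
    Summable fun α => ‖monomial Z α a b • c α‖ := by
  refine .of_nonneg_of_le (fun _ => norm_nonneg _) (fun α => ?_) (h n Z hZ).1
  rw [← entry_tens]
  exact norm_entry_le a b _

theorem ConvergesAbs.absSummableBelow (h : ConvergesAbs c f r) : AbsSummableBelow c r := by
  intro ρ h₀ hρ
  have hZ : ((ρ : ℂ) • 1 : Tuple d 1) ∈ complexBall d r 1 := fun i => by
    simpa [norm_smul, abs_of_nonneg h₀] using hρ
  have hone : ∀ α : Word d, monomial (1 : Tuple d 1) α = 1 := fun α =>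
    List.prod_eq_one (by simp)
  refine (h.summable_norm_entry hZ 0 0).congr fun α => ?_
  rw [monomial_smul, hone]
  simp [norm_smul, abs_of_nonneg h₀, mul_comm]

end Series

section Rays

theorem tendsto_inv_pow_smul_of_hasSum {ι X 𝕜 E : Type*} [NormedField 𝕜] [NormedAddCommGroup E]
    [NormedSpace 𝕜 E] [CompleteSpace E] {l : Filter X} {t : X → 𝕜} (ht : Tendsto t l (𝓝[≠] 0))
    {deg : ι → ℕ} {a : ι → E} {w₀ : ι} (ha : ∀ w, deg w ≤ deg w₀ → w ≠ w₀ → a w = 0)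
    {z : 𝕜} (hz : z ≠ 0) (hs : Summable fun w => ‖z ^ deg w • a w‖) {F : X → E}
    (hF : ∀ᶠ x in l, HasSum (fun w => t x ^ deg w • a w) (F x)) :
    Tendsto (fun x => (t x ^ deg w₀)⁻¹ • F x) l (𝓝 (a w₀)) := by
  classical
  have hdeg : ∀ s : 𝕜, s ≠ 0 → ∀ w,
      (s ^ deg w₀)⁻¹ • s ^ deg w • a w = s ^ (deg w - deg w₀) • a w := by
    intro s hs₀ w
    rcases le_or_gt (deg w₀) (deg w) with hw | hw
    · rw [smul_smul, pow_sub₀ s hs₀ hw, mul_comm]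
    · rw [ha w hw.le (by rintro rfl; exact hw.false), smul_zero, smul_zero, smul_zero]
  have hterm : ∀ w, Tendsto (fun x => t x ^ (deg w - deg w₀) • a w) l
      (𝓝 (if w = w₀ then a w₀ else 0)) := by
    intro w
    have hpow := ((ht.mono_right nhdsWithin_le_nhds).pow (deg w - deg w₀)).smul_const (a w)
    convert hpow using 2
    split_ifs with hw
    · subst hw
      simp
    · rcases le_or_gt (deg w) (deg w₀) with hle | hlt
      · rw [ha w hle hw, smul_zero]
      · rw [zero_pow (Nat.sub_ne_zero_of_lt hlt), zero_smul]
  have hbound : ∀ᶠ x in l, ∀ w,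
      ‖t x ^ (deg w - deg w₀) • a w‖ ≤ ‖(z ^ deg w₀)⁻¹‖ * ‖z ^ deg w • a w‖ := by
    have hsmall := (ht.mono_right nhdsWithin_le_nhds).norm.eventually_le_const
      (by simpa using hz : ‖(0 : 𝕜)‖ < ‖z‖)
    filter_upwards [hsmall] with x hx w
    rw [← norm_smul, hdeg z hz, norm_smul, norm_smul, norm_pow, norm_pow]
    gcongr
  have hlim := tendsto_tsum_of_dominated_convergence (hs.mul_left _) hterm hbound
  rw [tsum_ite_eq] at hlim
  refine hlim.congr' ?_
  filter_upwards [hF, ht.eventually_mem self_mem_nhdsWithin] with x hx hx₀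
  rw [← (hx.const_smul _).tsum_eq]
  exact tsum_congr fun w => (hdeg _ hx₀ w).symm

theorem eventually_smul_mem_complexBall {d n : ℕ} {r : ℝ} (hr : 0 < r) (Z : Tuple d n) :
    ∀ᶠ z : ℂ in 𝓝 0, z • Z ∈ complexBall d r n := by
  refine eventually_all.2 fun i => ?_
  have hlim : Tendsto (fun z : ℂ => ‖z • Z i‖) (𝓝 0) (𝓝 ‖(0 : ℂ) • Z i‖) :=
    Continuous.tendsto (by fun_prop) 0
  exact hlim.eventually_lt_const (by simpa using hr)

theorem tendsto_ofReal_nhdsGT_zero : Tendsto ((↑) : ℝ → ℂ) (𝓝[>] 0) (𝓝[≠] 0) := by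
  refine tendsto_nhdsWithin_iff.2 ⟨?_, ?_⟩
  · exact (Complex.continuous_ofReal.tendsto' 0 0 rfl).mono_left nhdsWithin_le_nhds
  · filter_upwards [self_mem_nhdsWithin] with s hs
    exact Complex.ofReal_ne_zero.2 (ne_of_gt hs)

theorem eventually_smul_mem_realBall {d n : ℕ} {r : ℝ} (hr : 0 < r) {X : Tuple d n}
    (hX : ∀ i, (X i).IsHermitian) : ∀ᶠ s : ℝ in 𝓝[>] 0, (s : ℂ) • X ∈ realBall d r n := by
  filter_upwards [(tendsto_ofReal_nhdsGT_zero.mono_right nhdsWithin_le_nhds).eventually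
    (eventually_smul_mem_complexBall hr X)] with s hs
  refine ⟨fun i => ?_, hs⟩
  rw [Pi.smul_apply, Matrix.IsHermitian, Matrix.conjTranspose_smul, hX i]
  simp

theorem ConvergesAbs.tendsto_entry {d n : ℕ} {K : Type*} [NormedAddCommGroup K]
    [InnerProductSpace ℂ K] [CompleteSpace K] {c : Word d → K →L[ℂ] K} {f : GradedFun d K} {r : ℝ}
    (h : ConvergesAbs c f r) (hr : 0 < r) {ι : Type*} [Fintype ι] (μ : ι → ℂ)
    (X : ι → Tuple d n) {a b : Fin n} {α₀ : Word d}
    (hX : ∀ α : Word d, α.length ≤ α₀.length →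
      ∑ j, μ j * monomial (X j) α a b = if α = α₀ then 1 else 0) :
    Tendsto (fun z : ℂ => (z ^ α₀.length)⁻¹ • entry a b (∑ j, μ j • f n (z • X j)))
      (𝓝[≠] 0) (𝓝 (c α₀)) := by
  have hball : ∀ᶠ z : ℂ in 𝓝[≠] 0, ∀ j, z • X j ∈ complexBall d r n :=
    nhdsWithin_le_nhds (eventually_all.2 fun j => eventually_smul_mem_complexBall hr (X j))
  have hterm : ∀ (z : ℂ) (α : Word d), ∑ j, μ j • monomial (z • X j) α a b • c α =
      z ^ α.length • (∑ j, μ j * monomial (X j) α a b) • c α := by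
    intro z α
    simp only [monomial_smul, Matrix.smul_apply, smul_smul, ← Finset.sum_smul, Finset.mul_sum,
      smul_eq_mul, mul_left_comm]
  have hsum : ∀ᶠ z : ℂ in 𝓝[≠] 0, HasSum
      (fun α => z ^ α.length • (∑ j, μ j * monomial (X j) α a b) • c α)
      (entry a b (∑ j, μ j • f n (z • X j))) := by
    filter_upwards [hball] with z hz
    simp only [← hterm, map_sum, map_smul]
    exact hasSum_sum fun j _ => (h.hasSum_entry (hz j) a b).const_smul (μ j)
  obtain ⟨z, hz, hz₀⟩ := (hball.and self_mem_nhdsWithin).exists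
  have hs : Summable fun α => ‖z ^ α.length • (∑ j, μ j * monomial (X j) α a b) • c α‖ := by
    simp only [← hterm]
    refine .of_nonneg_of_le (fun _ => norm_nonneg _) (fun α => norm_sum_le _ _)
      (summable_sum fun j _ => ?_)
    simpa only [norm_smul _ (_ • _)] using (h.summable_norm_entry (hz j) a b).mul_left ‖μ j‖
  have hlim := tendsto_inv_pow_smul_of_hasSum (w₀ := α₀) tendsto_id
    (fun α hα hne => by rw [hX α hα, if_neg hne, zero_smul]) hz₀ hs hsum
  rwa [hX α₀ le_rfl, if_pos rfl, one_smul] at hlim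

end Rays

section Fock

/-- The words of degree at most `N`, which index an orthonormal basis of the truncated full Fock
space. -/
abbrev BoundedWord (d N : ℕ) : Type := {w : Word d // w.length ≤ N}

theorem exists_equiv_boundedWord (d N : ℕ) : ∃ n, Nonempty (Fin n ≃ BoundedWord d N) := by
  have : Finite (BoundedWord d N) := (List.finite_length_le (Fin d) N).to_subtype
  obtain ⟨n, ⟨e⟩⟩ := Finite.exists_equiv_fin (BoundedWord d N)
  exact ⟨n, ⟨e.symm⟩⟩

variable {d N n : ℕ} (e : Fin n ≃ BoundedWord d N) (θ : ℝ)

/-- The truncated field operators `ℓ_i + ℓ_i*` on Fock space, where `ℓ_i w = w x_i`: the weighted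
adjacency matrices of the tree of words of degree at most `N`. The edges at the vacuum, that is
the empty word, have weight `θ` and all the others weight `1`. -/
def fock : Tuple d n := fun i => Matrix.of fun a c =>
  if (e c).1 = (e a).1 ++ [i] ∨ (e a).1 = (e c).1 ++ [i] then
    (if (e a).1 = [] ∨ (e c).1 = [] then (θ : ℂ) else 1) else 0

theorem fock_apply (i : Fin d) (a c : Fin n) : fock e θ i a c =
    if (e c).1 = (e a).1 ++ [i] ∨ (e a).1 = (e c).1 ++ [i] then
      (if (e a).1 = [] ∨ (e c).1 = [] then (θ : ℂ) else 1) else 0 := rfl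

theorem fock_isSymm (i : Fin d) : (fock e θ i).IsSymm := by
  ext a c
  simp only [Matrix.transpose_apply, fock_apply, or_comm]

theorem fock_isHermitian (i : Fin d) : (fock e θ i).IsHermitian := by
  ext a c
  rw [Matrix.conjTranspose_apply, (fock_isSymm e θ i).apply, fock_apply]
  split_ifs <;> simp

theorem fock_zero_eq_midpoint : fock e 0 = (2⁻¹ : ℂ) • (fock e 1 + fock e (-1)) := by
  ext i a c
  simp only [Pi.smul_apply, Pi.add_apply, Matrix.smul_apply, Matrix.add_apply, fock_apply,
    smul_eq_mul]
  split_ifs <;> norm_num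

variable {e θ}

theorem fock_eq_of_ne_vacuum {i : Fin d} {a c : Fin n} (ha : (e a).1 ≠ []) (hc : (e c).1 ≠ [])
    (θ' : ℝ) : fock e θ i a c = fock e θ' i a c := by
  simp only [fock_apply, ha, hc, or_self, if_false]

theorem fock_apply_parent {i j : Fin d} {p : Word d} {a c : Fin n} (ha : (e a).1 = p ++ [j])
    (hc : (e c).1 = p) : fock e θ i a c = if i = j then (if p = [] then (θ : ℂ) else 1) else 0 := by
  have hne : p ≠ p ++ [j] ++ [i] := fun h => by simpa using congrArg List.length h
  simp only [fock_apply, ha, hc, hne, false_or, List.append_cancel_left_eq, List.cons.injEq,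
    and_true, List.append_eq_nil_iff, List.cons_ne_nil, and_false, eq_comm (a := j)]

/-- A walk from `a` that is too short to go anywhere but straight to the vacuum and then along `b`
spells out `a` reversed and then `b`. -/
theorem walk_eq_ite {b : Word d} {κ : ℂ} {g : Word d → Fin n → ℂ}
    (hnil : ∀ a, (e a).1 ≠ [] → g [] a = 0)
    (hcons : ∀ i w a, (e a).1 ≠ [] → g (i :: w) a = ∑ c, fock e θ i a c * g w c)
    (hvac : ∀ w a, (e a).1 = [] → w.length ≤ b.length → g w a = if w = b then κ else 0)
    (w : Word d) {a : Fin n} (ha : (e a).1 ≠ []) (hw : w.length ≤ (e a).1.length + b.length) :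
    g w a = if w = (e a).1.reverse ++ b then θ * κ else 0 := by
  induction w generalizing a with
  | nil => rw [hnil a ha, if_neg fun h =>
    ha (List.reverse_eq_nil_iff.1 (List.append_eq_nil_iff.1 h.symm).1)]
  | cons i w ih =>
    obtain ⟨p, j, hp⟩ := (List.eq_nil_or_concat' (e a).1).resolve_left ha
    have hlen : (e a).1.length = p.length + 1 := by simp [hp]
    rw [List.length_cons, hlen] at hw
    obtain ⟨c₀, hc₀⟩ : ∃ c, (e c).1 = p :=
      ⟨e.symm ⟨p, by have := (e a).2; omega⟩, by rw [e.apply_symm_apply]⟩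
    have hoff : ∀ c, c ≠ c₀ → fock e θ i a c * g w c = 0 := by
      intro c hc
      by_cases hchild : (e c).1 = (e a).1 ++ [i]
      · have hclen : (e c).1.length = p.length + 2 := by simp [hchild, hlen]
        rw [ih (by simp [hchild]) (by omega), if_neg, mul_zero]
        intro h
        have := congrArg List.length h
        rw [List.length_append, List.length_reverse] at this
        omega
      · have hparent : (e a).1 ≠ (e c).1 ++ [i] := fun h =>
          hc (e.injective (Subtype.ext ((List.append_inj_left' (h.symm.trans hp) rfl).trans
            hc₀.symm)))
        rw [fock_apply, if_neg (by tauto), zero_mul]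
    rw [hcons i w a ha, Finset.sum_eq_single c₀ (fun c _ => hoff c) (by simp),
      fock_apply_parent hp hc₀, hp]
    by_cases hpnil : p = []
    · rw [hvac w c₀ (hc₀.trans hpnil) (by simp [hpnil] at hw; omega)]
      by_cases hij : i = j <;> simp [hpnil, hij]
    · rw [ih (hc₀ ▸ hpnil) (by rw [hc₀]; omega), hc₀]
      by_cases hij : i = j <;> simp [hpnil, hij]

theorem monomial_fock_to_vacuum {w : Word d} {a a₀ : Fin n} (ha₀ : (e a₀).1 = [])
    (ha : (e a).1 ≠ []) (hw : w.length ≤ (e a).1.length) :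
    monomial (fock e θ) w a a₀ = if w = (e a).1.reverse then (θ : ℂ) else 0 := by
  have hvac : ∀ a, (e a).1 = [] ↔ a = a₀ := fun a =>
    ⟨fun h => e.injective (Subtype.ext (h.trans ha₀.symm)), by rintro rfl; exact ha₀⟩
  have hwalk := walk_eq_ite (e := e) (θ := θ) (b := []) (κ := 1)
    (g := fun w a => monomial (fock e θ) w a a₀)
    (fun a h => Matrix.one_apply_ne fun h' => h ((hvac a).2 h'))
    (fun i w a _ => monomial_cons_apply _ i w a a₀)
    (fun w a h hw => by
      obtain rfl := (hvac a).1 h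
      obtain rfl := List.length_eq_zero_iff.1 (Nat.le_zero.1 hw)
      simp)
    w ha (by simpa using hw)
  simpa using hwalk

theorem monomial_fock_from_vacuum {w : Word d} {a a₀ : Fin n} (ha₀ : (e a₀).1 = [])
    (ha : (e a).1 ≠ []) (hw : w.length ≤ (e a).1.length) :
    monomial (fock e θ) w a₀ a = if w = (e a).1 then (θ : ℂ) else 0 := by
  rw [← Matrix.transpose_apply (monomial (fock e θ) w), ← monomial_reverse (fock_isSymm e θ),
    monomial_fock_to_vacuum ha₀ ha (by simpa using hw)]
  simp only [List.reverse_inj]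

theorem monomial_fock_one_to_vacuum {w : Word d} {a a₀ : Fin n} (ha₀ : (e a₀).1 = [])
    (hw : w.length ≤ (e a).1.length) :
    monomial (fock e 1) w a a₀ = if w = (e a).1.reverse then 1 else 0 := by
  by_cases ha : (e a).1 = []
  · obtain rfl : w = [] := List.length_eq_zero_iff.1 (Nat.le_zero.1 (by simpa [ha] using hw))
    obtain rfl : a = a₀ := e.injective (Subtype.ext (ha.trans ha₀.symm))
    simp [ha]
  · simpa using monomial_fock_to_vacuum (θ := 1) ha₀ ha hw

theorem monomial_fock_one_from_vacuum {w : Word d} {a a₀ : Fin n} (ha₀ : (e a₀).1 = [])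
    (hw : w.length ≤ (e a).1.length) :
    monomial (fock e 1) w a₀ a = if w = (e a).1 then 1 else 0 := by
  rw [← Matrix.transpose_apply (monomial (fock e 1) w), ← monomial_reverse (fock_isSymm e 1),
    monomial_fock_one_to_vacuum ha₀ (by simpa using hw)]
  simp only [List.reverse_inj]

theorem monomial_fock_zero_from_vacuum (w : Word d) {a b : Fin n} (ha : (e a).1 = [])
    (hb : (e b).1 ≠ []) : monomial (fock e 0) w a b = 0 := by
  cases w with
  | nil => exact Matrix.one_apply_ne (by rintro rfl; exact hb ha)
  | cons i w =>
    rw [monomial_cons_apply]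
    exact Finset.sum_eq_zero fun c _ => by simp [fock_apply, ha]

/-- Cutting the edges at the vacuum removes exactly the walks through the vacuum. -/
theorem monomial_fock_sub_monomial_fock_zero {w : Word d} {a b : Fin n} (ha : (e a).1 ≠ [])
    (hb : (e b).1 ≠ []) (hw : w.length ≤ (e a).1.length + (e b).1.length) :
    monomial (fock e θ) w a b - monomial (fock e 0) w a b =
      if w = (e a).1.reverse ++ (e b).1 then (θ : ℂ) ^ 2 else 0 := by
  have hwalk := walk_eq_ite (e := e) (θ := θ) (b := (e b).1) (κ := θ)
    (g := fun w a => monomial (fock e θ) w a b - monomial (fock e 0) w a b)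
    (fun a _ => by simp only [monomial_nil, sub_self])
    (fun i w a ha => by
      simp only [monomial_cons_apply, ← Finset.sum_sub_distrib, mul_sub]
      refine Finset.sum_congr rfl fun c _ => congrArg _ ?_
      by_cases hc : (e c).1 = []
      · simp only [monomial_fock_zero_from_vacuum w hc hb, mul_zero]
      · rw [fock_eq_of_ne_vacuum (θ := θ) ha hc 0])
    (fun w a ha hw => by
      rw [monomial_fock_zero_from_vacuum w ha hb, sub_zero, monomial_fock_from_vacuum ha hb hw])
    w ha hw
  rwa [← sq] at hwalk

end Fock

section Coefficients

variable {d n N : ℕ} {K : Type*} [NormedAddCommGroup K] [InnerProductSpace ℂ K]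
  {c : Word d → K →L[ℂ] K} {f : GradedFun d K} {r δ : ℝ}

theorem inner_sum_single_apply_sum_single {P : Type*} (S : Finset P) (t : P → ℂ) (idx : P → Fin n)
    (ξ : P → K) (A : Amp K n →L[ℂ] Amp K n) :
    inner ℂ (∑ p ∈ S, t p • single (idx p) (ξ p) : Amp K n)
        (A (∑ p ∈ S, t p • single (idx p) (ξ p))) =
      ∑ q ∈ S, ∑ p ∈ S,
        inner ℂ (ξ q) ((starRingEnd ℂ (t q) * t p) • entry (idx q) (idx p) A (ξ p)) := by
  simp only [map_sum, map_smul, sum_inner, inner_sum, inner_smul_left, inner_smul_right,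
    inner_single_apply_single, Finset.mul_sum]
  rw [Finset.sum_comm]
  exact Finset.sum_congr rfl fun q _ => Finset.sum_congr rfl fun p _ => by ring

/-- The midpoint convexity defect of `f` along the segment joining `s • fock e 1` and
`s • fock e (-1)`, whose midpoint is `s • fock e 0`. -/
def midpointDefect (f : GradedFun d K) (e : Fin n ≃ BoundedWord d N) (s : ℂ) :
    Amp K n →L[ℂ] Amp K n :=
  (2⁻¹ : ℂ) • (f n (s • fock e 1) + f n (s • fock e (-1))) - f n (s • fock e 0)

variable [CompleteSpace K]

theorem ConvergesAbs.tendsto_entry_midpointDefect (h : ConvergesAbs c f r) (hr : 0 < r)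
    {e : Fin n ≃ BoundedWord d N} {a b : Fin n} (ha : (e a).1 ≠ []) (hb : (e b).1 ≠ []) :
    Tendsto (fun z => (z ^ ((e a).1.reverse ++ (e b).1).length)⁻¹ •
      entry a b (midpointDefect f e z)) (𝓝[≠] 0) (𝓝 (c ((e a).1.reverse ++ (e b).1))) := by
  have hlim := h.tendsto_entry hr ![2⁻¹, 2⁻¹, -1] ![fock e 1, fock e (-1), fock e 0]
    (a := a) (b := b) (α₀ := (e a).1.reverse ++ (e b).1) fun α hα => by
      rw [List.length_append, List.length_reverse] at hα
      have hplus := monomial_fock_sub_monomial_fock_zero (θ := 1) ha hb hα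
      have hminus := monomial_fock_sub_monomial_fock_zero (θ := -1) ha hb hα
      simp only [Fin.sum_univ_three, Matrix.cons_val]
      rw [sub_eq_iff_eq_add.1 hplus, sub_eq_iff_eq_add.1 hminus]
      push_cast
      split_ifs <;> ring
  refine hlim.congr fun z => ?_
  simp [midpointDefect, Fin.sum_univ_three, sub_eq_add_neg]

theorem eventually_midpointDefect_nonneg (hδ : 0 < δ) (hf : MatrixConvexOn (realBall d δ) f)
    (e : Fin n ≃ BoundedWord d N) : ∀ᶠ s : ℝ in 𝓝[>] 0, 0 ≤ midpointDefect f e s := by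
  filter_upwards [eventually_smul_mem_realBall hδ (fock_isHermitian e 1),
    eventually_smul_mem_realBall hδ (fock_isHermitian e (-1))] with s hplus hminus
  have hmid := hf.2 n _ hplus _ hminus
  rw [← smul_add, smul_comm, ← fock_zero_eq_midpoint] at hmid
  exact sub_nonneg.2 hmid

/-- Testing the convexity defect at `∑ s^{-|p|} ξ_p ⊗ e_p` and letting `s → 0` isolates the
coefficients `c_{q* p}`. -/
theorem ConvergesAbs.form_re_nonneg (h : ConvergesAbs c f r) (hr : 0 < r) (hδ : 0 < δ)
    (hf : MatrixConvexOn (realBall d δ) f) (ξ : PosWord d →₀ K) : 0 ≤ (form c ξ ξ).re := by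
  obtain ⟨n, ⟨e⟩⟩ := exists_equiv_boundedWord d (ξ.support.sup fun p => p.1.length)
  have hex : ∀ p ∈ ξ.support, ∃ a, (e a).1 = p.1 := fun p hp =>
    ⟨e.symm ⟨p.1, Finset.le_sup (f := fun p : PosWord d => p.1.length) hp⟩, by simp⟩
  have : Nonempty (Fin n) := ⟨e.symm ⟨[], Nat.zero_le _⟩⟩
  choose! idx hidx using hex
  let ψ : ℝ → Amp K n := fun s =>
    ∑ p ∈ ξ.support, ((s : ℂ) ^ p.1.length)⁻¹ • single (idx p) (ξ p)
  have hlim : Tendsto (fun s : ℝ => inner ℂ (ψ s) (midpointDefect f e s (ψ s))) (𝓝[>] 0)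
      (𝓝 (form c ξ ξ)) := by
    simp only [ψ, inner_sum_single_apply_sum_single, form, Finsupp.sum]
    refine tendsto_finsetSum _ fun q hq => tendsto_finsetSum _ fun p hp => ?_
    have hcoeff := h.tendsto_entry_midpointDefect hr (e := e) (a := idx q) (b := idx p)
      (by rw [hidx q hq]; exact q.2) (by rw [hidx p hp]; exact p.2)
    rw [hidx q hq, hidx p hp] at hcoeff
    refine (tendsto_const_nhds.inner (((ContinuousLinearMap.apply ℂ K (ξ p)).continuous.tendsto
      _).comp (hcoeff.comp tendsto_ofReal_nhdsGT_zero))).congr fun s => ?_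
    simp only [Function.comp_apply, ContinuousLinearMap.apply_apply, List.length_append,
      List.length_reverse, pow_add, mul_inv, map_inv₀, map_pow, Complex.conj_ofReal,
      _root_.smul_apply]
  refine ge_of_tendsto ((Complex.continuous_re.tendsto _).comp hlim) ?_
  filter_upwards [eventually_midpointDefect_nonneg hδ hf e] with s hs
  exact ((ContinuousLinearMap.nonneg_iff_isPositive _).1 hs).re_inner_nonneg_right (ψ s)

theorem ConvergesAbs.adjoint_coeff (h : ConvergesAbs c f r) (hr : 0 < r) (hδ : 0 < δ)
    (hf : ∀ n, ∀ X ∈ realBall d δ n, IsSelfAdjoint (f n X)) (α : Word d) :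
    adjoint (c α) = c α.reverse := by
  obtain ⟨n, ⟨e⟩⟩ := exists_equiv_boundedWord d α.length
  obtain ⟨a, ha⟩ : ∃ a, (e a).1 = α := ⟨e.symm ⟨α, le_rfl⟩, by simp⟩
  obtain ⟨a₀, ha₀⟩ : ∃ a, (e a).1 = [] := ⟨e.symm ⟨[], Nat.zero_le _⟩, by simp⟩
  have hfrom := h.tendsto_entry hr (fun _ : Unit => 1) (fun _ => fock e 1) (a := a₀) (b := a)
    (α₀ := α) fun w hw => by
      simpa [ha] using monomial_fock_one_from_vacuum (w := w) (a := a) ha₀ (by rwa [ha])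
  have hto := h.tendsto_entry hr (fun _ : Unit => 1) (fun _ => fock e 1) (a := a) (b := a₀)
    (α₀ := α.reverse) fun w hw => by
      simpa [ha] using monomial_fock_one_to_vacuum (w := w) (a := a) ha₀
        (by rwa [ha, ← α.length_reverse])
  have hadj := (adjoint.continuous.tendsto _).comp (hfrom.comp tendsto_ofReal_nhdsGT_zero)
  refine tendsto_nhds_unique (hadj.congr' ?_) (hto.comp tendsto_ofReal_nhdsGT_zero)
  filter_upwards [eventually_smul_mem_realBall hδ (fock_isHermitian e 1)] with s hs
  simp only [Function.comp_apply, Finset.univ_unique, Finset.sum_singleton, one_smul, map_smulₛₗ,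
    adjoint_entry, (hf n _ hs).adjoint_eq, map_inv₀, map_pow, Complex.conj_ofReal,
    List.length_reverse]

theorem ConvergesAbs.isPositiveKernel (h : ConvergesAbs c f r) (hr : 0 < r) (hδ : 0 < δ)
    (hf : MatrixConvexOn (realBall d δ) f) : IsPositiveKernel c where
  hermitian α β := by
    rw [h.adjoint_coeff hr hδ hf.1]
    simp [Word.adj]
  nonneg := h.form_re_nonneg hr hδ hf

end Coefficients

section Shift

variable {d : ℕ} {K : Type*} [NormedAddCommGroup K] [InnerProductSpace ℂ K]

theorem form_mapDomain_right (c : Word d → K →L[ℂ] K) (g : PosWord d → PosWord d)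
    (ξ η : PosWord d →₀ K) : form c ξ (Finsupp.mapDomain g η) =
      ξ.sum fun β w => η.sum fun α v => inner ℂ w (c (β.1.adj ++ (g α).1) v) := by
  unfold form
  refine Finsupp.sum_congr fun β _ => ?_
  rw [Finsupp.sum_mapDomain_index] <;> simp

theorem form_mapDomain_left (c : Word d → K →L[ℂ] K) (g : PosWord d → PosWord d)
    (ξ η : PosWord d →₀ K) : form c (Finsupp.mapDomain g ξ) η =
      ξ.sum fun β w => η.sum fun α v => inner ℂ w (c ((g β).1.adj ++ α.1) v) := by
  unfold form
  rw [Finsupp.sum_mapDomain_index] <;> simp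

theorem form_single_single (c : Word d → K →L[ℂ] K) (α β : PosWord d) (v w : K) :
    form c (Finsupp.single β w) (Finsupp.single α v) = inner ℂ w (c (β.1.adj ++ α.1) v) := by
  simp [form]

theorem AbsSummableBelow.exists_norm_append_le {E : Type*} [SeminormedAddCommGroup E]
    {c : Word d → E} {r ρ : ℝ} (hc : AbsSummableBelow c r) (h₀ : 0 < ρ) (hρ : ρ < r)
    (β α : Word d) :
    ∃ C, ∀ k, ∑ φ : Fin k → Fin d, ‖c (β ++ (List.ofFn φ ++ α))‖ ≤ C * ρ⁻¹ ^ k := by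
  refine ⟨(∑' w, ‖c w‖ * ρ ^ w.length) * ρ⁻¹ ^ (β.length + α.length), fun k => ?_⟩
  have hinj : Function.Injective fun φ : Fin k → Fin d => β ++ (List.ofFn φ ++ α) :=
    fun φ ψ hφ => List.ofFn_injective (List.append_cancel_right (List.append_cancel_left hφ))
  rw [mul_assoc, ← pow_add, inv_pow, ← div_eq_mul_inv, le_div_iff₀ (by positivity),
    Finset.sum_mul]
  calc ∑ φ : Fin k → Fin d, ‖c (β ++ (List.ofFn φ ++ α))‖ * ρ ^ (β.length + α.length + k)
      = ∑ w ∈ Finset.univ.map ⟨_, hinj⟩, ‖c w‖ * ρ ^ w.length := by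
        rw [Finset.sum_map]
        refine Finset.sum_congr rfl fun φ _ => ?_
        simp only [Function.Embedding.coeFn_mk, List.length_append, List.length_ofFn]
        congr 2
        omega
    _ ≤ _ := (hc ρ h₀.le hρ).sum_le_tsum _ fun _ _ => by positivity

variable [CompleteSpace K] {c : Word d → K →L[ℂ] K} {r : ℝ} (h : IsPositiveKernel c)

/-- The identification of finite sums of symbols with `PreSpace h`, as a linear equivalence so that
the definition of `PreSpace h` need not be unfolded. -/
def ofFinsupp : (PosWord d →₀ K) ≃ₗ[ℂ] PreSpace h :=
  LinearEquiv.refl ℂ (PosWord d →₀ K)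

theorem inner_ofFinsupp (ξ η : PosWord d →₀ K) :
    inner ℂ (ofFinsupp h ξ) (ofFinsupp h η) = form c ξ η := rfl

theorem vec_eq_coe (α : PosWord d) (v : K) :
    vec h α v = (ofFinsupp h (Finsupp.single α v) : Space h) := rfl

theorem span_ofFinsupp_single :
    Submodule.span ℂ {ξ | ∃ α v, ξ = ofFinsupp h (Finsupp.single α v)} = ⊤ := by
  refine Submodule.eq_top_iff'.2 fun ξ => ?_
  obtain ⟨ξ, rfl⟩ := (ofFinsupp h).surjective ξ
  induction ξ using Finsupp.induction_linear with
  | zero => simp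
  | add ξ η hξ hη => simpa using Submodule.add_mem _ hξ hη
  | single α v => exact Submodule.subset_span ⟨α, v, rfl⟩

/-- Left multiplication by `x_i` on finite sums of symbols. -/
def preShift (i : Fin d) : PreSpace h →ₗ[ℂ] PreSpace h :=
  (ofFinsupp h).toLinearMap ∘ₗ Finsupp.lmapDomain K ℂ (PosWord.cons i) ∘ₗ
    (ofFinsupp h).symm.toLinearMap

theorem preShift_ofFinsupp (i : Fin d) (ξ : PosWord d →₀ K) :
    preShift h i (ofFinsupp h ξ) = ofFinsupp h (Finsupp.mapDomain (PosWord.cons i) ξ) := by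
  simp [preShift]

theorem preShift_isSymmetric (i : Fin d) : (preShift h i).IsSymmetric := by
  intro ξ η
  obtain ⟨ξ, rfl⟩ := (ofFinsupp h).surjective ξ
  obtain ⟨η, rfl⟩ := (ofFinsupp h).surjective η
  rw [preShift_ofFinsupp, preShift_ofFinsupp, inner_ofFinsupp, inner_ofFinsupp,
    form_mapDomain_left, form_mapDomain_right]
  simp [PosWord.cons, Word.adj]

theorem preShift_pow_single (i : Fin d) (k : ℕ) (α : PosWord d) (v : K) :
    (preShift h i ^ k) (ofFinsupp h (Finsupp.single α v)) =
      ofFinsupp h (Finsupp.single ((PosWord.cons i)^[k] α) v) := by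
  induction k with
  | zero => rfl
  | succ k ih =>
    rw [pow_succ', Module.End.mul_apply, ih, preShift_ofFinsupp, Finsupp.mapDomain_single,
      Function.iterate_succ_apply']

theorem iterate_cons_val (i : Fin d) (k : ℕ) (α : PosWord d) :
    ((PosWord.cons i)^[k] α).1 = List.ofFn (fun _ : Fin k => i) ++ α.1 := by
  induction k with
  | zero => simp
  | succ k ih => simp [Function.iterate_succ_apply', PosWord.cons, ih, List.ofFn_succ]

theorem norm_preShift_le_inv {ρ : ℝ} (hc : AbsSummableBelow c r) (h₀ : 0 < ρ) (hρ : ρ < r)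
    (i : Fin d) (ξ : PreSpace h) : ‖preShift h i ξ‖ ≤ ρ⁻¹ * ‖ξ‖ := by
  refine norm_apply_le_of_isSymmetric_of_mem_span (preShift_isSymmetric h i)
    (inv_nonneg.2 h₀.le) (S := {ξ | ∃ α v, ξ = ofFinsupp h (Finsupp.single α v)}) ?_
    (span_ofFinsupp_single h ▸ Submodule.mem_top)
  rintro _ ⟨α, v, rfl⟩
  obtain ⟨C, hC⟩ := hc.exists_norm_append_le h₀ hρ α.1.adj α.1
  refine ⟨C * (‖v‖ * ‖v‖), fun k => ?_⟩
  rw [preShift_pow_single, inner_ofFinsupp, form_single_single, iterate_cons_val]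
  calc _ ≤ ‖v‖ * (‖c (α.1.adj ++ (List.ofFn (fun _ : Fin k => i) ++ α.1))‖ * ‖v‖) :=
        (norm_inner_le_norm _ _).trans
          (mul_le_mul_of_nonneg_left (ContinuousLinearMap.le_opNorm _ _) (norm_nonneg v))
    _ = ‖c (α.1.adj ++ (List.ofFn (fun _ : Fin k => i) ++ α.1))‖ * (‖v‖ * ‖v‖) := by ring
    _ ≤ C * ρ⁻¹ ^ k * (‖v‖ * ‖v‖) := by
        gcongr
        exact (Finset.single_le_sum (f := fun φ : Fin k → Fin d =>
          ‖c (α.1.adj ++ (List.ofFn φ ++ α.1))‖) (fun _ _ => norm_nonneg _)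
          (Finset.mem_univ fun _ => i)).trans (hC k)
    _ = C * (‖v‖ * ‖v‖) * ρ⁻¹ ^ k := by ring

theorem norm_preShift_le (hr : 0 < r) (hc : AbsSummableBelow c r) (i : Fin d) (ξ : PreSpace h) :
    ‖preShift h i ξ‖ ≤ r⁻¹ * ‖ξ‖ := by
  have hlim : Tendsto (fun ρ : ℝ => ρ⁻¹ * ‖ξ‖) (𝓝[<] r) (𝓝 (r⁻¹ * ‖ξ‖)) :=
    ((tendsto_inv₀ hr.ne').mono_left nhdsWithin_le_nhds).mul_const _
  refine ge_of_tendsto hlim ?_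
  filter_upwards [self_mem_nhdsWithin, nhdsWithin_le_nhds (lt_mem_nhds hr)] with ρ hρ h₀
  exact norm_preShift_le_inv h hc h₀ hρ i ξ

/-- Left multiplication by `x_i` on the Hilbert space. -/
def shift (hr : 0 < r) (hc : AbsSummableBelow c r) (i : Fin d) : Space h →L[ℂ] Space h :=
  ((preShift h i).mkContinuous r⁻¹ (norm_preShift_le h hr hc i)).completion

theorem shift_coe (hr : 0 < r) (hc : AbsSummableBelow c r) (i : Fin d) (ξ : PreSpace h) :
    shift h hr hc i (ξ : Space h) = (preShift h i ξ : Space h) := by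
  simp [shift]

theorem shift_vec (hr : 0 < r) (hc : AbsSummableBelow c r) (i : Fin d) (α : PosWord d) (v : K) :
    shift h hr hc i (vec h α v) = vec h (PosWord.cons i α) v := by
  rw [vec_eq_coe, shift_coe, preShift_ofFinsupp, Finsupp.mapDomain_single, vec_eq_coe]

theorem norm_shift_le (hr : 0 < r) (hc : AbsSummableBelow c r) (i : Fin d) :
    ‖shift h hr hc i‖ ≤ r⁻¹ := by
  refine ContinuousLinearMap.opNorm_le_bound _ (inv_nonneg.2 hr.le) fun x => ?_
  induction x using UniformSpace.Completion.induction_on with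
  | hp => exact isClosed_le (by fun_prop) (by fun_prop)
  | ih ξ =>
    rw [shift_coe, UniformSpace.Completion.norm_coe, UniformSpace.Completion.norm_coe]
    exact norm_preShift_le h hr hc i ξ

theorem shift_isSelfAdjoint (hr : 0 < r) (hc : AbsSummableBelow c r) (i : Fin d) :
    IsSelfAdjoint (shift h hr hc i) := by
  rw [ContinuousLinearMap.isSelfAdjoint_iff_isSymmetric]
  intro x y
  induction x, y using UniformSpace.Completion.induction_on₂ with
  | hp =>
    simp only [ContinuousLinearMap.coe_coe]
    exact isClosed_eq (by fun_prop) (by fun_prop)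
  | ih ξ η =>
    simp only [ContinuousLinearMap.coe_coe, shift_coe, UniformSpace.Completion.inner_coe]
    exact preShift_isSymmetric h i ξ η

theorem norm_vec_le (α : PosWord d) (v : K) :
    ‖vec h α v‖ ≤ √‖c (α.1.adj ++ α.1)‖ * ‖v‖ := by
  rw [← Real.sqrt_sq (norm_nonneg v), ← Real.sqrt_mul (norm_nonneg _)]
  refine Real.le_sqrt_of_sq_le ?_
  rw [← inner_self_eq_norm_sq (𝕜 := ℂ), inner_vec]
  calc _ ≤ ‖v‖ * ‖c (α.1.adj ++ α.1) v‖ := (RCLike.re_le_norm _).trans (norm_inner_le_norm _ _)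
    _ ≤ ‖v‖ * (‖c (α.1.adj ++ α.1)‖ * ‖v‖) := by
        gcongr
        exact ContinuousLinearMap.le_opNorm _ _
    _ = _ := by ring

/-- The map `v ↦ α ⊗ v` from `K` to the Hilbert space. -/
def vecL (α : PosWord d) : K →L[ℂ] Space h :=
  LinearMap.mkContinuous
    ((UniformSpace.Completion.toComplₗᵢ (𝕜 := ℂ) (E := PreSpace h)).toLinearMap ∘ₗ
      (ofFinsupp h).toLinearMap ∘ₗ Finsupp.lsingle α) _ (norm_vec_le h α)

theorem vecL_apply (α : PosWord d) (v : K) : vecL h α v = vec h α v := rfl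

end Shift

section Pencil

variable {H : Type*} [NormedAddCommGroup H] [InnerProductSpace ℂ H] {d n : ℕ}
  (T : Fin d → H →L[ℂ] H)

/-- The linear pencil `∑ T_i ⊗ Z_i`. -/
def pencil (Z : Tuple d n) : Amp H n →L[ℂ] Amp H n :=
  ∑ i, tens (T i) (Z i)

theorem prod_ofFn_pencil {k : ℕ} (Z : Fin k → Tuple d n) :
    (List.ofFn fun j => pencil T (Z j)).prod =
      ∑ φ : Fin k → Fin d,
        tens ((List.ofFn φ).map T).prod (List.ofFn fun j => Z j (φ j)).prod := by
  have hexpand := (MultilinearMap.mkPiAlgebraFin ℂ k (Amp H n →L[ℂ] Amp H n)).map_sum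
    fun j i => tens (T i) (Z j i)
  simp only [MultilinearMap.mkPiAlgebraFin_apply, prod_ofFn_tens] at hexpand
  simp only [pencil, hexpand, List.map_ofFn, Function.comp_def]

theorem pencil_pow (Z : Tuple d n) (k : ℕ) :
    pencil T Z ^ k =
      ∑ φ : Fin k → Fin d, tens ((List.ofFn φ).map T).prod (monomial Z (List.ofFn φ)) := by
  simpa only [List.ofFn_const, List.prod_replicate, monomial, List.map_ofFn, Function.comp_def]
    using prod_ofFn_pencil T fun _ : Fin k => Z

variable {T} in
theorem adjoint_pencil [CompleteSpace H] (hT : ∀ i, IsSelfAdjoint (T i))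
    (Z : Tuple d n) : adjoint (pencil T Z) = pencil T fun i => (Z i).conjTranspose := by
  simp only [pencil, map_sum, adjoint_tens, (hT _).adjoint_eq]

end Pencil

theorem norm_matrix_apply_le {n : ℕ} (M : Matrix (Fin n) (Fin n) ℂ) (a b : Fin n) :
    ‖M a b‖ ≤ ‖M‖ := by
  have h := Matrix.l2_opNorm_mulVec M (EuclideanSpace.single b 1)
  rw [PiLp.norm_single, norm_one, mul_one] at h
  simpa using (PiLp.norm_apply_le _ a).trans h

theorem norm_prod_ofFn_apply_le {n k : ℕ} {ρ : ℝ} {M : Fin k → Matrix (Fin n) (Fin n) ℂ}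
    (hM : ∀ j, ‖M j‖ ≤ ρ) (a b : Fin n) : ‖(List.ofFn M).prod a b‖ ≤ ρ ^ k := by
  have : Nonempty (Fin n) := ⟨a⟩
  refine (norm_matrix_apply_le _ a b).trans ((List.norm_prod_le _).trans ?_)
  rw [List.map_ofFn, List.prod_ofFn]
  simpa using Finset.prod_le_prod (s := Finset.univ) (fun j _ => norm_nonneg (M j)) fun j _ => hM j

section Contraction

variable {d n : ℕ} {K : Type*} [NormedAddCommGroup K] [InnerProductSpace ℂ K] [CompleteSpace K]
  {c : Word d → K →L[ℂ] K} (h : IsPositiveKernel c)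

theorem dense_span_vec :
    Dense (Submodule.span ℂ {x | ∃ α v, x = vec h α v} : Set (Space h)) := by
  refine (UniformSpace.Completion.denseRange_coe (α := PreSpace h)).mono ?_
  have hle : ⊤ ≤ (Submodule.span ℂ {x | ∃ α v, x = vec h α v}).comap
      (UniformSpace.Completion.toComplₗᵢ (𝕜 := ℂ) (E := PreSpace h)).toLinearMap := by
    rw [← span_ofFinsupp_single, Submodule.span_le]
    rintro _ ⟨α, v, rfl⟩
    exact Submodule.subset_span ⟨α, v, rfl⟩
  rintro _ ⟨ξ, rfl⟩
  exact hle (Submodule.mem_top (x := ξ))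

theorem dense_span_single_vec (n : ℕ) :
    Dense (Submodule.span ℂ {z : Amp (Space h) n | ∃ a α v, z = single a (vec h α v)} :
      Set (Amp (Space h) n)) := by
  set S : Submodule ℂ (Amp (Space h) n) := Submodule.span ℂ {z | ∃ a α v, z = single a (vec h α v)}
  rw [Submodule.dense_iff_topologicalClosure_eq_top, Submodule.eq_top_iff']
  intro z
  rw [← sum_single z]
  refine Submodule.sum_mem _ fun a _ => ?_
  have hspan : Submodule.span ℂ {x | ∃ α v, x = vec h α v} ≤ S.comap (single a).toLinearMap :=
    Submodule.span_le.2 fun _ ⟨α, v, hx⟩ => Submodule.subset_span ⟨a, α, v, congrArg _ hx⟩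
  exact (dense_span_vec h).induction (fun x hx => S.le_topologicalClosure (hspan hx))
    (S.isClosed_topologicalClosure.preimage (single a).continuous) (z a)

variable {h} {T : Fin d → Space h →L[ℂ] Space h}

theorem prod_map_vec (hT : ∀ i α v, T i (vec h α v) = vec h (PosWord.cons i α) v) (w : Word d)
    (α : PosWord d) (v : K) :
    (w.map T).prod (vec h α v) = vec h ⟨w ++ α.1, by simp [α.2]⟩ v := by
  induction w with
  | nil => simp
  | cons i w ih =>
    rw [List.map_cons, List.prod_cons, mul_apply_eq_comp, ih, hT]
    rfl

theorem inner_vec_prod_map_vec (hT : ∀ i α v, T i (vec h α v) = vec h (PosWord.cons i α) v)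
    (w : Word d) (α β : PosWord d) (v u : K) :
    inner ℂ (vec h β u) ((w.map T).prod (vec h α v)) = inner ℂ u (c (β.1.adj ++ (w ++ α.1)) v) := by
  rw [prod_map_vec hT, inner_vec]

theorem norm_inner_prod_pencil_le (hT : ∀ i α v, T i (vec h α v) = vec h (PosWord.cons i α) v)
    {ρ : ℝ} {k : ℕ} {Z : Fin k → Tuple d n} (hZ : ∀ j i, ‖Z j i‖ ≤ ρ) (a b : Fin n)
    (α β : PosWord d) (v u : K) :
    ‖inner ℂ (single a (vec h β u)) ((List.ofFn fun j => pencil T (Z j)).prod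
        (single b (vec h α v)))‖ ≤
      ρ ^ k * (∑ φ : Fin k → Fin d, ‖c (β.1.adj ++ (List.ofFn φ ++ α.1))‖) * (‖u‖ * ‖v‖) := by
  rw [prod_ofFn_pencil, inner_single_apply_single, map_sum, sum_apply, inner_sum, Finset.mul_sum,
    Finset.sum_mul]
  refine norm_sum_le_of_le _ fun φ _ => ?_
  rw [entry_tens, _root_.smul_apply, inner_smul_right, inner_vec_prod_map_vec hT, norm_mul,
    mul_assoc]
  have hcoef : ‖inner ℂ u (c (β.1.adj ++ (List.ofFn φ ++ α.1)) v)‖ ≤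
      ‖c (β.1.adj ++ (List.ofFn φ ++ α.1))‖ * (‖u‖ * ‖v‖) := by
    rw [mul_left_comm]
    exact (norm_inner_le_norm _ _).trans
      (mul_le_mul_of_nonneg_left (ContinuousLinearMap.le_opNorm _ _) (norm_nonneg u))
  exact mul_le_mul (norm_prod_ofFn_apply_le (fun j => hZ j (φ j)) a b) hcoef (norm_nonneg _)
    ((norm_nonneg _).trans (norm_prod_ofFn_apply_le (fun j => hZ j (φ j)) a b))

theorem exists_norm_inner_prod_pencil_le {r ρ σ : ℝ} (hc : AbsSummableBelow c r)
    (hT : ∀ i α v, T i (vec h α v) = vec h (PosWord.cons i α) v) (hρ : 0 ≤ ρ) (h₀ : 0 < σ)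
    (hσ : σ < r) (a : Fin n) (α : PosWord d) (v : K) :
    ∃ C, ∀ (l : List (Tuple d n)), (∀ Z ∈ l, ∀ i, ‖Z i‖ ≤ ρ) →
      ‖inner ℂ (single a (vec h α v)) ((l.map (pencil T)).prod (single a (vec h α v)))‖ ≤
        C * (ρ / σ) ^ l.length := by
  obtain ⟨C, hC⟩ := hc.exists_norm_append_le h₀ hσ α.1.adj α.1
  refine ⟨C * (‖v‖ * ‖v‖), fun l hl => ?_⟩
  have hword := norm_inner_prod_pencil_le hT (Z := fun j : Fin l.length => l[(j : ℕ)])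
    (fun j => hl _ (l.getElem_mem j.2)) a a α α v v
  rw [List.ofFn_getElem_eq_map l (pencil T)] at hword
  calc _ ≤ _ := hword
    _ ≤ ρ ^ l.length * (C * σ⁻¹ ^ l.length) * (‖v‖ * ‖v‖) := by gcongr; exact hC _
    _ = _ := by rw [div_eq_mul_inv, mul_pow]; ring

theorem exists_prod_eq_star_mul_self_pow (hsa : ∀ i, IsSelfAdjoint (T i)) {ρ : ℝ}
    {Z : Tuple d n} (hZ : ∀ i, ‖Z i‖ ≤ ρ) (k : ℕ) :
    ∃ l : List (Tuple d n), l.length = 2 * k ∧ (∀ W ∈ l, ∀ i, ‖W i‖ ≤ ρ) ∧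
      (l.map (pencil T)).prod = (star (pencil T Z) * pencil T Z) ^ k := by
  induction k with
  | zero => exact ⟨[], by simp⟩
  | succ k ih =>
    obtain ⟨l, hlen, hl, hprod⟩ := ih
    refine ⟨(fun i => (Z i).conjTranspose) :: Z :: l, by simp [hlen]; ring, ?_, ?_⟩
    · simpa [Matrix.l2_opNorm_conjTranspose] using ⟨hZ, hl⟩
    · rw [List.map_cons, List.map_cons, List.prod_cons, List.prod_cons, hprod, ← mul_assoc,
        pow_succ', ContinuousLinearMap.star_eq_adjoint, adjoint_pencil hsa]

theorem norm_pencil_le {r ρ σ : ℝ} (hc : AbsSummableBelow c r)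
    (hT : ∀ i α v, T i (vec h α v) = vec h (PosWord.cons i α) v)
    (hsa : ∀ i, IsSelfAdjoint (T i)) (hρ : 0 ≤ ρ) (h₀ : 0 < σ) (hσ : σ < r)
    {Z : Tuple d n} (hZ : ∀ i, ‖Z i‖ ≤ ρ) : ‖pencil T Z‖ ≤ ρ / σ := by
  set A := star (pencil T Z) * pencil T Z
  have hsym : (A : Amp (Space h) n →ₗ[ℂ] Amp (Space h) n).IsSymmetric :=
    (ContinuousLinearMap.isSelfAdjoint_iff_isSymmetric).1 (IsSelfAdjoint.star_mul_self _)
  have hA : ∀ z, ‖A z‖ ≤ (ρ / σ) ^ 2 * ‖z‖ := by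
    refine (dense_span_single_vec h n).induction (fun z hz => ?_)
      (isClosed_le (by fun_prop) (by fun_prop))
    refine norm_apply_le_of_isSymmetric_of_mem_span hsym (by positivity) ?_ hz
    rintro _ ⟨a, α, v, rfl⟩
    obtain ⟨C, hC⟩ := exists_norm_inner_prod_pencil_le hc hT hρ h₀ hσ a α v
    refine ⟨C, fun k => ?_⟩
    obtain ⟨l, hlen, hl, hprod⟩ := exists_prod_eq_star_mul_self_pow hsa hZ k
    rw [← ContinuousLinearMap.toLinearMap_pow, ← pow_mul, ← hlen, ← hprod]
    exact hC l hl
  refine (pow_le_pow_iff_left₀ (norm_nonneg _) (by positivity) two_ne_zero).1 ?_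
  rw [sq, ← CStarRing.norm_star_mul_self]
  exact ContinuousLinearMap.opNorm_le_bound _ (by positivity) hA

theorem norm_pencil_lt_one {r : ℝ} (hr : 0 < r) (hc : AbsSummableBelow c r)
    (hT : ∀ i α v, T i (vec h α v) = vec h (PosWord.cons i α) v)
    (hsa : ∀ i, IsSelfAdjoint (T i)) {Z : Tuple d n} (hZ : Z ∈ complexBall d r n) :
    ‖pencil T Z‖ < 1 := by
  have hnear : ∀ᶠ ρ in 𝓝[<] r, 0 < ρ ∧ ∀ i, ‖Z i‖ < ρ :=
    nhdsWithin_le_nhds ((lt_mem_nhds hr).and (eventually_all.2 fun i => lt_mem_nhds (hZ i)))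
  obtain ⟨ρ, ⟨h₀, hρ⟩, hρr⟩ := (hnear.and self_mem_nhdsWithin).exists
  obtain ⟨σ, hσ, hσr⟩ := exists_between (show ρ < r from hρr)
  exact (norm_pencil_le hc hT hsa h₀.le (h₀.trans hσ) hσr fun i => (hρ i).le).trans_lt
    ((div_lt_one (h₀.trans hσ)).2 hσ)

end Contraction

section WordSums

variable {d : ℕ} {M : Type*} [AddCommMonoid M]

theorem sum_ofFn_succ_concat (k : ℕ) (g : Word d → M) :
    ∑ φ : Fin (k + 1) → Fin d, g (List.ofFn φ) =
      ∑ i, ∑ φ : Fin k → Fin d, g (List.ofFn φ ++ [i]) := by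
  rw [← Fintype.sum_prod_type', ← (Fin.snocEquiv fun _ : Fin (k + 1) => Fin d).sum_comp]
  refine Fintype.sum_congr _ _ fun x => ?_
  rw [List.ofFn_succ']
  simp [Fin.snocEquiv]

theorem sum_ofFn_succ_cons (k : ℕ) (g : Word d → M) :
    ∑ φ : Fin (k + 1) → Fin d, g (List.ofFn φ) =
      ∑ i, ∑ φ : Fin k → Fin d, g (i :: List.ofFn φ) := by
  rw [← Fintype.sum_prod_type', ← (Fin.consEquiv fun _ : Fin (k + 1) => Fin d).sum_comp]
  refine Fintype.sum_congr _ _ fun x => ?_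
  rw [List.ofFn_succ]
  simp [Fin.consEquiv]

theorem hasSum_degree {E : Type*} [NormedAddCommGroup E] {g : Word d → E} {a : E}
    (h : HasSum g a) : HasSum (fun k => ∑ φ : Fin k → Fin d, g (List.ofFn φ)) a := by
  have hsigma : HasSum (fun x : Σ k, Fin k → Fin d => g (List.ofFn x.2)) a :=
    (List.equivSigmaTuple (α := Fin d)).symm.hasSum_iff.2 h
  exact hsigma.sigma fun k => hasSum_fintype _

end WordSums

section Realization

variable {d n : ℕ} {K : Type*} [NormedAddCommGroup K] [InnerProductSpace ℂ K] [CompleteSpace K]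
  {c : Word d → K →L[ℂ] K} {h : IsPositiveKernel c} {T : Fin d → Space h →L[ℂ] Space h}
  {Q : Fin d → K →L[ℂ] Space h}

theorem adjoint_comp_prod_map_comp (hT : ∀ i α v, T i (vec h α v) = vec h (PosWord.cons i α) v)
    (hQ : ∀ i v, Q i v = vec h (PosWord.letter i) v) (i j : Fin d) (w : Word d) :
    adjoint (Q i) ∘L (w.map T).prod ∘L Q j = c (i :: w ++ [j]) := by
  ext v
  refine ext_inner_left ℂ fun u => ?_
  rw [ContinuousLinearMap.comp_apply, ContinuousLinearMap.adjoint_inner_right,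
    ContinuousLinearMap.comp_apply, hQ, hQ, inner_vec_prod_map_vec hT]
  simp [PosWord.letter, Word.adj]

theorem adjoint_comp_pencil_pow_comp (hT : ∀ i α v, T i (vec h α v) = vec h (PosWord.cons i α) v)
    (hQ : ∀ i v, Q i v = vec h (PosWord.letter i) v) (Z : Tuple d n) (k : ℕ) :
    adjoint (∑ i, tens (Q i) (Z i).conjTranspose) ∘L (pencil T Z ^ k) ∘L
        (∑ i, tens (Q i) (Z i)) =
      ∑ φ : Fin (k + 2) → Fin d, tens (c (List.ofFn φ)) (monomial Z (List.ofFn φ)) := by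
  rw [sum_ofFn_succ_concat (k + 1) fun w => tens (c w) (monomial Z w), pencil_pow]
  simp only [map_sum, adjoint_tens, Matrix.conjTranspose_conjTranspose,
    ContinuousLinearMap.finsetSum_comp, ContinuousLinearMap.comp_finsetSum, tens_comp,
    adjoint_comp_prod_map_comp hT hQ]
  refine Finset.sum_congr rfl fun j _ => ?_
  rw [sum_ofFn_succ_cons k fun w => tens (c (w ++ [j])) (monomial Z (w ++ [j])), Finset.sum_comm]
  refine Finset.sum_congr rfl fun i _ => Finset.sum_congr rfl fun φ _ => ?_
  simp [monomial_append]

theorem hasSum_adjoint_comp_inverse_comp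
    (hT : ∀ i α v, T i (vec h α v) = vec h (PosWord.cons i α) v)
    (hQ : ∀ i v, Q i v = vec h (PosWord.letter i) v) {Z : Tuple d n} (hZ : ‖pencil T Z‖ < 1) :
    HasSum
      (fun k => ∑ φ : Fin (k + 2) → Fin d, tens (c (List.ofFn φ)) (monomial Z (List.ofFn φ)))
      (adjoint (∑ i, tens (Q i) (Z i).conjTranspose) ∘L Ring.inverse (1 - pencil T Z) ∘L
        (∑ i, tens (Q i) (Z i))) := by
  simp only [← adjoint_comp_pencil_pow_comp hT hQ Z]
  exact ((hasSum_geom_series_inverse _ hZ).mapL ((∑ i, tens (Q i) (Z i)).precomp _)).mapL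
    ((adjoint (∑ i, tens (Q i) (Z i).conjTranspose)).postcomp _)

theorem eq_realization_of_hasSum
    (hT : ∀ i α v, T i (vec h α v) = vec h (PosWord.cons i α) v)
    (hQ : ∀ i v, Q i v = vec h (PosWord.letter i) v) {Z : Tuple d n} (hZ : ‖pencil T Z‖ < 1)
    {F : Amp K n →L[ℂ] Amp K n} (hF : HasSum (fun α => tens (c α) (monomial Z α)) F) :
    F = tens (c []) 1 + ∑ i, tens (c [i]) (Z i) +
      adjoint (∑ i, tens (Q i) (Z i).conjTranspose) ∘L
        Ring.inverse (1 - pencil T Z) ∘L (∑ i, tens (Q i) (Z i)) := by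
  rw [← ((hasSum_nat_add_iff' 2).2 (hasSum_degree hF)).unique
    (hasSum_adjoint_comp_inverse_comp hT hQ hZ), Finset.sum_range_succ, Finset.sum_range_one,
    sum_ofFn_succ_concat 0 fun w => tens (c w) (monomial Z w)]
  simp

end Realization

section LinearPart

variable {d : ℕ} {K : Type*} [NormedAddCommGroup K] [InnerProductSpace ℂ K]

/-- The continuous real-linear map `t ↦ ∑ i, t i • c_{x_i}`, the linear part of the series. -/
def linearPart (c : Word d → K →L[ℂ] K) : (Fin d → ℝ) →L[ℝ] (K →L[ℂ] K) :=
  ∑ i, (ContinuousLinearMap.proj (R := ℝ) (φ := fun _ : Fin d => ℝ) i).smulRight (c [i])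

theorem linearPart_apply (c : Word d → K →L[ℂ] K) (t : Fin d → ℝ) :
    linearPart c t = ∑ i, t i • c [i] := by
  simp [linearPart]

theorem linearPart_single_one (c : Word d → K →L[ℂ] K) (i : Fin d) :
    linearPart c (Pi.single i 1) = c [i] := by
  simp [linearPart_apply, Pi.single_apply]

theorem linearPart_isSelfAdjoint [CompleteSpace K] {c : Word d → K →L[ℂ] K}
    (hc : ∀ i, IsSelfAdjoint (c [i])) (t : Fin d → ℝ) : IsSelfAdjoint (linearPart c t) := by
  rw [linearPart_apply]
  exact isSelfAdjoint_sum _ fun i _ => (IsSelfAdjoint.all (t i)).smul (hc i)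

end LinearPart

end Butterfly

end

theorem mainTheorem7_general {d : ℕ} {K : Type*} [NormedAddCommGroup K] [InnerProductSpace ℂ K]
    [CompleteSpace K] {r δ : ℝ} (hr : 0 < r) (hδ : 0 < δ)
    (c : Word d → K →L[ℂ] K) (f : GradedFun d K)
    (hconv : ConvergesAbs c f r) (hf : MatrixConvexOn (realBall d δ) f) :
    ∃ h : IsPositiveKernel c,
    ∃ (T : Fin d → Space h →L[ℂ] Space h) (Q : Fin d → K →L[ℂ] Space h),
      (∀ i α v, T i (vec h α v) = vec h (PosWord.cons i α) v) ∧
      (∀ i v, Q i v = vec h (PosWord.letter i) v) ∧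
      (∀ i, IsSelfAdjoint (T i)) ∧
      (∀ i, ‖T i‖ ≤ r⁻¹) ∧
      ∃ (a₀ : K →L[ℂ] K) (L : (Fin d → ℝ) →L[ℝ] (K →L[ℂ] K)),
        IsSelfAdjoint a₀ ∧ (∀ t, IsSelfAdjoint (L t)) ∧
        ∀ n, ∀ Z ∈ complexBall d r n,
          IsUnit (1 - ∑ i, tens (T i) (Z i)) ∧
          f n Z = tens a₀ 1 + ∑ i, tens (L (Pi.single i 1)) (Z i) +
            ContinuousLinearMap.adjoint (∑ i, tens (Q i) (Z i).conjTranspose) ∘L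
              Ring.inverse (1 - ∑ i, tens (T i) (Z i)) ∘L
              (∑ i, tens (Q i) (Z i)) := by
  have h := hconv.isPositiveKernel hr hδ hf
  have hc := hconv.absSummableBelow
  have hadj := hconv.adjoint_coeff hr hδ hf.1
  have hT := shift_vec h hr hc
  have hQ := fun i => vecL_apply h (PosWord.letter i)
  have hsa := shift_isSelfAdjoint h hr hc
  refine ⟨h, shift h hr hc, fun i => vecL h (PosWord.letter i), hT, hQ, hsa,
    norm_shift_le h hr hc, c [], linearPart c, hadj [],
    linearPart_isSelfAdjoint fun i => hadj [i], fun n Z hZ => ?_⟩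
  have hlt := norm_pencil_lt_one hr hc hT hsa hZ
  simp only [linearPart_single_one]
  exact ⟨isUnit_one_sub_of_norm_lt_one hlt, eq_realization_of_hasSum hT hQ hlt (hconv n Z hZ).2⟩

theorem mainTheorem7 {d : ℕ} {K : Type*} [NormedAddCommGroup K] [InnerProductSpace ℂ K]
    [CompleteSpace K] (ε : ℝ) (hε : 0 < ε)
    (c : Word d → K →L[ℂ] K) (f : GradedFun d K)
    (hconv : ConvergesAbsUnif c f (1 + ε))
    (hf : MatrixConvexOn (realBall d (1 + ε)) f) :
    -- the block matrix is positive, so it defines the Hilbert space `Space h`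
    ∃ h : IsPositiveKernel c,
    ∃ (T : Fin d → Space h →L[ℂ] Space h) (Q : Fin d → K →L[ℂ] Space h),
      (∀ i α v, T i (vec h α v) = vec h (PosWord.cons i α) v) ∧
      (∀ i v, Q i v = vec h (PosWord.letter i) v) ∧
      (∀ i, IsSelfAdjoint (T i)) ∧
      (∀ i, ‖T i‖ ≤ 1) ∧
      ∃ (a₀ : K →L[ℂ] K) (L : (Fin d → ℝ) →L[ℝ] (K →L[ℂ] K)),
        IsSelfAdjoint a₀ ∧ (∀ t, IsSelfAdjoint (L t)) ∧
        ∀ n, ∀ Z ∈ complexBall d (1 + ε) n,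
          IsUnit (1 - ∑ i, tens (T i) (Z i)) ∧
          f n Z = tens a₀ 1 + ∑ i, tens (L (Pi.single i 1)) (Z i) +
            ContinuousLinearMap.adjoint (∑ i, tens (Q i) (Z i).conjTranspose) ∘L
              Ring.inverse (1 - ∑ i, tens (T i) (Z i)) ∘L
              (∑ i, tens (Q i) (Z i)) := by
  have hr : 0 < 1 + ε := by linarith
  obtain ⟨h, T, Q, hT, hQ, hsa, hnorm, hrest⟩ :=
    mainTheorem7_general hr hr c f hconv.convergesAbs hf
  exact ⟨h, T, Q, hT, hQ, hsa,
    fun i => (hnorm i).trans (inv_le_one_of_one_le₀ (by linarith)), hrest⟩
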